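/- Let $(X,d_X)$ and $(Y,d_Y)$ be Hadamard spaces, i.e. complete $\mathrm{CAT}(0)$ spaces, and let $f\colon X\times Y\to\mathbb R$ be a function such that $f(\cdot,y)$ is upper semicontinuous and (geodesically) concave for each $y\in Y$, and $f(x,\cdot)$ is lower semicontinuous and (geodesically) convex for each $x\in X$. Let $d$ be the $\ell^2$-metric on $X\times Y$, $d((x,y),(x',y'))=\sqrt{d_X(x,x')^2+d_Y(y,y')^2}$. A saddle point of a function $g\colon X\times Y\to\mathbb R$ is a point $(x_0,y_0)$ with $g(x,y_0)\le g(x_0,y_0)\le g(x_0,y)$ for all $(x,y)\in X\times Y$; the set of all of them is denoted by $\mathrm{Saddle}(g)$. For $\lambda>0$ let $R_\lambda$ be the resolvent of $\lambda f$, which maps $(x,y)\in X\times Y$ to the unique saddle point of $$(u,v)\mapsto \lambda f(u,v)-\tfrac12 d_X(u,x)^2+\tfrac12 d_Y(v,y)^2 ,$$ and write $R_\lambda(x,y)=(R_{1,\lambda}(x,y),R_{2,\lambda}(x,y))$. Then the following hold. (i) For each $\lambda>0$, $R_\lambda$ is a well-defined single-valued mapping of $X\times Y$ into itself (for each $(x,y)\in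 X\times Y$ the above function has exactly one saddle point), and $\mathrm{Fix}(R_\lambda)=\mathrm{Saddle}(f)$, where $\mathrm{Fix}(R_\lambda)$ is the set of fixed points of $R_\lambda$. (ii) For all $\lambda>0$ and all $u=(x,y)$, $u'=(x',y')$ in $X\times Y$, $$d(R_\lambda u,u')^2+d(R_\lambda u,u)^2+2\lambda\bigl\{f(x',R_{2,\lambda}u)-f(R_{1,\lambda}u,y')\bigr\}\le d(u,u')^2 .$$ (iii) For all $\lambda,\mu>0$ and all $u,u'\in X\times Y$, $$(\lambda+\mu)\,d(R_\lambda u,R_\mu u')^2+\mu\, d(R_\lambda u,u)^2+\lambda\, d(R_\mu u',u')^2\le \lambda\, d(R_\lambda u,u')^2+\mu\, d(R_\mu u',u)^2 .$$ (iv) For each $\lambda>0$, $R_\lambda$ is firmly metrically nonspreading, i.e. $$2d(R_\lambda u,R_\lambda v)^2+d(R_\lambda u,u)^2+d(R_\lambda v,v)^2\le d(R_\lambda u,v)^2+d(R_\lambda v,u)^2\quad\text{for all }u,v\in X\times Y,$$ and nonexpansive, i.e. $d(R_\lambda u,R_\lambda v)\le d(u,v)$ for all $u,v\in X\times Y$.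 (v) For all $\lambda,\mu>0$ and $u\in X\times Y$, $$\frac1\mu\, d(R_\mu R_\lambda u,R_\lambda u)\le\frac1\lambda\, d(R_\lambda u,u).$$ -/

import Mathlib

open Set

noncomputable section

/-- `γ : [0,1] → X` is a normalized geodesic from `x` to `y`. -/
structure IsNormalizedGeodesic {X : Type*} [MetricSpace X] (γ : unitInterval → X) (x y : X) :
    Prop where
  source : γ 0 = x
  target : γ 1 = y
  dist_eq : ∀ s t : unitInterval, dist (γ s) (γ t) = dist x y * |(s : ℝ) - (t : ℝ)|

/-- A `CAT(0)` space: a geodesic metric space in which the distance between points on two sides of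
a geodesic triangle is at most the distance between the corresponding points of a comparison
triangle in the Euclidean plane. -/
structure IsCATZero (X : Type*) [MetricSpace X] : Prop where
  geodesic : ∀ x y : X, ∃ γ : unitInterval → X, IsNormalizedGeodesic γ x y
  comparison : ∀ (x y z : X) (γ₁ γ₂ : unitInterval → X),
    IsNormalizedGeodesic γ₁ x y → IsNormalizedGeodesic γ₂ x z →
    ∀ x' y' z' : EuclideanSpace ℝ (Fin 2),
      dist x y = ‖x' - y'‖ → dist y z = ‖y' - z'‖ → dist z x = ‖z' - x'‖ →
    ∀ α β : unitInterval,
      dist (γ₁ α) (γ₂ β) ≤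
        ‖((1 - (α : ℝ)) • x' + (α : ℝ) • y') - ((1 - (β : ℝ)) • x' + (β : ℝ) • z')‖

/-- A Hadamard space: a complete `CAT(0)` space. -/
structure IsHadamardSpace (X : Type*) [MetricSpace X] : Prop where
  catZero : IsCATZero X
  complete : CompleteSpace X

/-- Convexity along geodesics. In a `CAT(0)` space normalized geodesics are unique, and `γ α` is
the convex combination `(1 - α) x ⊕ α y`. -/
def GeodesicConvex {X : Type*} [MetricSpace X] (g : X → ℝ) : Prop :=
  ∀ (x y : X) (γ : unitInterval → X), IsNormalizedGeodesic γ x y →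
    ∀ α : unitInterval, g (γ α) ≤ (1 - (α : ℝ)) * g x + (α : ℝ) * g y

/-- Concavity along geodesics. -/
def GeodesicConcave {X : Type*} [MetricSpace X] (g : X → ℝ) : Prop :=
  GeodesicConvex (fun x => -g x)

/-- `f : X × Y → ℝ` (written in curried form) is upper semicontinuous and concave in its first
variable and lower semicontinuous and convex in its second variable. -/
structure IsSaddleFunction {X Y : Type*} [MetricSpace X] [MetricSpace Y] (f : X → Y → ℝ) :
    Prop where
  usc : ∀ y : Y, UpperSemicontinuous (fun x => f x y)
  concave : ∀ y : Y, GeodesicConcave (fun x => f x y)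
  lsc : ∀ x : X, LowerSemicontinuous (fun y => f x y)
  convex : ∀ x : X, GeodesicConvex (fun y => f x y)

/-- The set of saddle points of `f` in `X × Y`: a maximum in the first variable and a minimum in
the second one. `WithLp 2 (X × Y)` is `X × Y` with the `ℓ²`-metric. -/
def saddleSet {X Y : Type*} (f : X → Y → ℝ) : Set (WithLp 2 (X × Y)) :=
  {p | ∀ (x : X) (y : Y), f x p.snd ≤ f p.fst p.snd ∧ f p.fst p.snd ≤ f p.fst y}

/-- The function `(x, y) ↦ f(x, y) - d(x, a)² / 2 + d(y, b)² / 2`, where `u = (a, b)`. -/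
def proxFunction {X Y : Type*} [MetricSpace X] [MetricSpace Y] (f : X → Y → ℝ)
    (u : WithLp 2 (X × Y)) : X → Y → ℝ :=
  fun x y => f x y - (1 / 2) * dist x u.fst ^ 2 + (1 / 2) * dist y u.snd ^ 2

open Classical in
/-- The resolvent of `f`: it maps `u` to the saddle point of `proxFunction f u` (and, as a
convention, to `u` if there were none). -/
def saddleResolvent {X Y : Type*} [MetricSpace X] [MetricSpace Y] (f : X → Y → ℝ)
    (u : WithLp 2 (X × Y)) : WithLp 2 (X × Y) :=
  if h : (saddleSet (proxFunction f u)).Nonempty then h.some else u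

/-- `scaledResolvent f l` is the resolvent `R_l` of `l f`. -/
def scaledResolvent {X Y : Type*} [MetricSpace X] [MetricSpace Y] (f : X → Y → ℝ) (l : ℝ) :
    WithLp 2 (X × Y) → WithLp 2 (X × Y) :=
  saddleResolvent (fun x y => l * f x y)

/-- Firmly metrically nonspreading mappings of a metric space. -/
def FirmlyMetricallyNonspreading {Z : Type*} [MetricSpace Z] (T : Z → Z) : Prop :=
  ∀ u v : Z, 2 * dist (T u) (T v) ^ 2 + dist (T u) u ^ 2 + dist (T v) v ^ 2 ≤
    dist (T u) v ^ 2 + dist (T v) u ^ 2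

/-- Nonexpansive mappings of a metric space. -/
def Nonexpansive {Z : Type*} [MetricSpace Z] (T : Z → Z) : Prop :=
  ∀ u v : Z, dist (T u) (T v) ≤ dist u v

end

/-!
Write `g = proxFunction (l f) u`. By the `CAT(0)` inequality, `g` is strongly concave in its first
and strongly convex in its second variable, with modulus `1`.

A strongly convex lower semicontinuous function `h` on a Hadamard space is bounded below (lower
semicontinuity at a single point and convexity suffice), minimizing sequences are Cauchy, and the
minimizer `a` satisfies the quadratic growth `h a + d(x, a)² / 2 ≤ h x`
(`StronglyGeodesicConvex.exists_quadratic_growth`).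

Existence of a saddle point (`exists_saddle_point`) needs no weak compactness. The function
`φ y = max_x g(x, y)` is again strongly convex and lower semicontinuous; let `b` be its minimizer
and `a` the maximizer of `g(·, b)`. For a point `y_t` on the geodesic from `b` to `y` and the
maximizer `x_t` of `g(·, y_t)`, convexity in the second variable, quadratic growth at `a`, and
`φ b ≤ φ y_t` give `φ b + (1 - t) / (2 t) d(x_t, a)² ≤ g(x_t, y) ≤ φ y`. So `x_t → a` as `t → 0`,
and upper semicontinuity yields `g(a, b) = φ b ≤ g(a, y)`.

Quadratic growth in both variables at the saddle point is the resolvent inequality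
`saddle_prox_inequality`, which also gives uniqueness. The remaining claims follow from it by
arithmetic; nonexpansiveness uses in addition the quadrilateral inequality of `CAT(0)` spaces,
`IsCATZero.quadrilateral`.
-/

open Filter Topology

/-! ### Inequalities in `CAT(0)` spaces -/

/-- Three distances satisfying the triangle inequalities are realized by a Euclidean triangle. -/
theorem exists_comparison_triangle {a b c : ℝ} (ha : 0 ≤ a) (hb : 0 ≤ b) (hc : 0 ≤ c)
    (h₁ : a ≤ b + c) (h₂ : b ≤ a + c) (h₃ : c ≤ a + b) :
    ∃ x y z : EuclideanSpace ℝ (Fin 2), a = ‖x - y‖ ∧ b = ‖y - z‖ ∧ c = ‖z - x‖ := by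
  rcases ha.eq_or_lt with rfl | ha
  · have hbc : b = c := by linarith
    subst hbc
    refine ⟨0, 0, !₂[b, 0], by simp, ?_, ?_⟩ <;>
      simp [EuclideanSpace.norm_eq, Fin.sum_univ_two, Real.sqrt_sq hb]
  -- `x` is the origin, `y` lies on the first axis, and the law of cosines determines `z`.
  · obtain ⟨p, hp⟩ : ∃ p : ℝ, 2 * a * p = a ^ 2 + c ^ 2 - b ^ 2 :=
      ⟨(a ^ 2 + c ^ 2 - b ^ 2) / (2 * a), by field_simp⟩
    have hq : 0 ≤ c ^ 2 - p ^ 2 := by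
      have h : 0 ≤ (2 * a) ^ 2 * (c ^ 2 - p ^ 2) := by
        have : (2 * a) ^ 2 * (c ^ 2 - p ^ 2)
            = ((b + c - a) * (a + c + b)) * ((a + b - c) * (a + c - b)) := by
          have : (2 * a) ^ 2 * (c ^ 2 - p ^ 2) = (2 * a * c) ^ 2 - (2 * a * p) ^ 2 := by ring
          rw [this, hp]; ring
        rw [this]
        apply mul_nonneg <;> apply mul_nonneg <;> linarith
      exact nonneg_of_mul_nonneg_right h (by positivity)
    refine ⟨0, !₂[a, 0], !₂[p, √(c ^ 2 - p ^ 2)], ?_, ?_, ?_⟩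
    · simp [EuclideanSpace.norm_eq, Fin.sum_univ_two, Real.sqrt_sq ha.le]
    · simp only [EuclideanSpace.norm_eq, Fin.sum_univ_two]
      simp only [PiLp.sub_apply, Real.norm_eq_abs, sq_abs]
      simp only [Matrix.cons_val_zero, Matrix.cons_val_one, zero_sub, neg_sq, Real.sq_sqrt hq]
      rw [eq_comm, Real.sqrt_eq_iff_mul_self_eq (by nlinarith [sq_nonneg (a - p)]) hb]
      linarith
    · simp only [EuclideanSpace.norm_eq, Fin.sum_univ_two]
      simp [Real.sq_sqrt hq, Real.sqrt_sq hc]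

theorem IsNormalizedGeodesic.dist_source {X : Type*} [MetricSpace X] {γ : unitInterval → X}
    {x y : X} (hγ : IsNormalizedGeodesic γ x y) (t : unitInterval) :
    dist (γ t) x = t * dist x y := by
  have := hγ.dist_eq t 0
  rw [hγ.source] at this
  rw [this]
  simp [abs_of_nonneg t.2.1, mul_comm]

/-- The squared distance to a point is strongly convex in a `CAT(0)` space (the inequality of
Bruhat and Tits). -/
theorem IsCATZero.dist_sq_le {X : Type*} [MetricSpace X] (hX : IsCATZero X) {x y : X}
    {γ : unitInterval → X} (hγ : IsNormalizedGeodesic γ x y) (z : X) (t : unitInterval) :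
    dist (γ t) z ^ 2 ≤ (1 - (t : ℝ)) * dist x z ^ 2 + t * dist y z ^ 2
      - t * (1 - t) * dist x y ^ 2 := by
  obtain ⟨σ, hσ⟩ := hX.geodesic x z
  obtain ⟨x', y', z', h₁, h₂, h₃⟩ := exists_comparison_triangle (a := dist x y) (b := dist y z)
    (c := dist z x) dist_nonneg dist_nonneg dist_nonneg
    (by rw [dist_comm z x, dist_comm y z, add_comm]; exact dist_triangle x z y)
    (by rw [dist_comm x y, dist_comm z x]; exact dist_triangle y x z)
    (by rw [dist_comm z x]; exact dist_triangle x y z)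
  have h := hX.comparison x y z γ σ hγ hσ x' y' z' h₁ h₂ h₃ t 1
  rw [hσ.target] at h
  have hn : ((1 - (t : ℝ)) • x' + (t : ℝ) • y')
      - ((1 - ((1 : unitInterval) : ℝ)) • x' + ((1 : unitInterval) : ℝ) • z')
      = (1 - (t : ℝ)) • (x' - z') + (t : ℝ) • (y' - z') := by
    simp only [Set.Icc.coe_one]
    module
  rw [hn] at h
  have hxy : x' - y' = (x' - z') - (y' - z') := by abel
  have e₁ := norm_sub_sq_real (x' - z') (y' - z')
  have e₂ := norm_add_sq_real ((1 - (t : ℝ)) • (x' - z')) ((t : ℝ) • (y' - z'))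
  rw [norm_smul, norm_smul, real_inner_smul_left, real_inner_smul_right, mul_pow, mul_pow,
    Real.norm_eq_abs, Real.norm_eq_abs, sq_abs, sq_abs] at e₂
  rw [← hxy] at e₁
  rw [dist_comm x z, h₁, h₂, h₃, norm_sub_rev z' x']
  have h' := pow_le_pow_left₀ dist_nonneg h 2
  nlinarith

/-- The Berg–Nikolaev quadrilateral inequality. -/
theorem IsCATZero.quadrilateral {X : Type*} [MetricSpace X] (hX : IsCATZero X) (a b c d : X) :
    dist a c ^ 2 + dist b d ^ 2 ≤ dist a d ^ 2 + dist b c ^ 2 + 2 * (dist a b * dist c d) := by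
  rcases (dist_nonneg : 0 ≤ dist a b).eq_or_lt with hab | hab
  · obtain rfl := dist_eq_zero.1 hab.symm
    simp [add_comm]
  rcases (dist_nonneg : 0 ≤ dist c d).eq_or_lt with hcd | hcd
  · obtain rfl := dist_eq_zero.1 hcd.symm
    simp
  obtain ⟨γ, hγ⟩ := hX.geodesic b d
  set p := dist a b with hp
  set q := dist c d with hq
  have hpq : 0 < p + q := by positivity
  -- Bound `d(a, c)` through the point dividing the diagonal `[b, d]` in the ratio
  -- `d(a, b) : d(c, d)`; this choice turns the weighted side lengths into `2 * p * q`.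
  obtain ⟨t, ht⟩ : ∃ t : unitInterval, (t : ℝ) = p / (p + q) :=
    ⟨⟨p / (p + q), by positivity, by rw [div_le_one hpq]; linarith⟩, rfl⟩
  have ha := hX.dist_sq_le hγ a t
  have hc := hX.dist_sq_le hγ c t
  have hac : dist a c ≤ dist (γ t) a + dist (γ t) c := dist_triangle_left a c (γ t)
  have ht' : 1 - (t : ℝ) = q / (p + q) := by rw [ht]; field_simp; ring
  rw [ht', ht, dist_comm b a, dist_comm d a, ← hp] at ha
  rw [ht', ht, dist_comm d c, ← hq] at hc
  set m := dist (γ t) a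
  set n := dist (γ t) c
  have hm : (p + q) ^ 2 * m ^ 2
      ≤ (p + q) * q * p ^ 2 + (p + q) * p * dist a d ^ 2 - p * q * dist b d ^ 2 := by
    calc _ ≤ (p + q) ^ 2 * _ := mul_le_mul_of_nonneg_left ha (by positivity)
      _ = _ := by field_simp
  have hn : (p + q) ^ 2 * n ^ 2
      ≤ (p + q) * q * dist b c ^ 2 + (p + q) * p * q ^ 2 - p * q * dist b d ^ 2 := by
    calc _ ≤ (p + q) ^ 2 * _ := mul_le_mul_of_nonneg_left hc (by positivity)
      _ = _ := by field_simp
  have hsq : dist a c ^ 2 ≤ (m + n) ^ 2 := pow_le_pow_left₀ dist_nonneg hac 2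
  -- Cauchy–Schwarz with the weights `p` and `q`.
  have hw : p * q * (m + n) ^ 2 ≤ (p + q) * (q * m ^ 2 + p * n ^ 2) := by
    nlinarith [sq_nonneg (q * m - p * n)]
  have key : (p * q * (p + q)) * (dist a c ^ 2 + dist b d ^ 2)
      ≤ (p * q * (p + q)) * (dist a d ^ 2 + dist b c ^ 2 + 2 * (p * q)) := by
    have h₁ := mul_le_mul_of_nonneg_left hm hcd.le
    have h₂ := mul_le_mul_of_nonneg_left hn hab.le
    have h₃ := mul_le_mul_of_nonneg_left hw hpq.le
    have h₄ := mul_le_mul_of_nonneg_left hsq (by positivity : 0 ≤ p * q * (p + q))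
    nlinarith
  exact le_of_mul_le_mul_left key (by positivity)

/-! ### Strongly convex functions on Hadamard spaces -/

/-- Strong convexity along geodesics, with modulus `1`. -/
def StronglyGeodesicConvex {X : Type*} [MetricSpace X] (h : X → ℝ) : Prop :=
  ∀ (x y : X) (γ : unitInterval → X), IsNormalizedGeodesic γ x y → ∀ t : unitInterval,
    h (γ t) ≤ (1 - (t : ℝ)) * h x + t * h y - 1 / 2 * (t * (1 - t) * dist x y ^ 2)

/-- Lower semicontinuity bounds `h` below on a small ball around a point `o`. Comparing `h x` with
the value where the geodesic from `o` to `x` leaves half that ball bounds `h` elsewhere: the loss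
is linear in `d(o, x)`, while strong convexity contributes a quadratic gain. -/
theorem StronglyGeodesicConvex.bddBelow {X : Type*} [MetricSpace X] (hX : IsCATZero X)
    {h : X → ℝ} (hh : StronglyGeodesicConvex h) (hl : LowerSemicontinuous h) :
    BddBelow (Set.range h) := by
  rcases isEmpty_or_nonempty X with hE | ⟨⟨o⟩⟩
  · simp [Set.range_eq_empty]
  obtain ⟨r, hr, hball⟩ := Metric.eventually_nhds_iff.1 (hl o (h o - 1) (by linarith))
  -- Outside the ball, `h x ≥ h o - K * s + s ^ 2 / 2` with `s = dist o x`, `K = 2 / r + r / 4`.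
  refine ⟨h o - 1 - (2 / r + r / 4) ^ 2, ?_⟩
  rintro _ ⟨x, rfl⟩
  rcases lt_or_ge (dist x o) r with hx | hx
  · nlinarith [hball hx, sq_nonneg (2 / r + r / 4)]
  obtain ⟨γ, hγ⟩ := hX.geodesic o x
  rw [dist_comm] at hx
  set s := dist o x with hs
  have hs0 : 0 < s := hr.trans_le hx
  obtain ⟨t, ht⟩ : ∃ t : unitInterval, (t : ℝ) = (r / 2) / s :=
    ⟨⟨(r / 2) / s, by positivity, by rw [div_le_one hs0]; linarith⟩, rfl⟩
  have hts : (t : ℝ) * s = r / 2 := by rw [ht]; field_simp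
  have ht0 : 0 < (t : ℝ) := by rw [ht]; positivity
  have h₁ : h o - 1 < h (γ t) := hball (by rw [hγ.dist_source, ← hs, hts]; linarith)
  have h₂ := hh o x γ hγ t
  rw [← hs] at h₂
  have hrs : 1 = t * (2 / r * s) := by rw [ht]; field_simp
  have h₃ : t * (h o - (2 / r + r / 4) * s + s ^ 2 / 2) ≤ t * h x := by
    have : (t : ℝ) * (1 - t) * s ^ 2 = t * (s ^ 2 - r / 2 * s) := by rw [← hts]; ring
    rw [this] at h₂
    nlinarith
  have h₄ := le_of_mul_le_mul_left h₃ ht0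
  nlinarith [sq_nonneg (s - (2 / r + r / 4))]

theorem StronglyGeodesicConvex.quadratic_growth {X : Type*} [MetricSpace X] (hX : IsCATZero X)
    {h : X → ℝ} (hh : StronglyGeodesicConvex h) {a : X} (ha : ∀ x, h a ≤ h x) (y : X) :
    h a + 1 / 2 * dist y a ^ 2 ≤ h y := by
  by_contra! hlt
  have hay : h a ≤ h y := ha y
  obtain ⟨γ, hγ⟩ := hX.geodesic a y
  rw [dist_comm] at hlt
  set A := 1 / 2 * dist a y ^ 2 with hA
  have hA0 : 0 < A := by linarith
  -- `t` is such that `(1 - t) * A` is the mean of `A` and `h y - h a`.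
  obtain ⟨t, ht⟩ : ∃ t : unitInterval, (t : ℝ) = (A - (h y - h a)) / (2 * A) :=
    ⟨⟨(A - (h y - h a)) / (2 * A), div_nonneg (by linarith) (by linarith),
      by rw [div_le_one (by linarith)]; linarith⟩, rfl⟩
  have ht0 : 0 < (t : ℝ) := by rw [ht]; exact div_pos (by linarith) (by linarith)
  have htA : t * A = (A - (h y - h a)) / 2 := by rw [ht]; field_simp
  have h₁ := hh a y γ hγ t
  have h₂ := ha (γ t)
  have h₃ : 0 ≤ t * (h y - h a - (1 - t) * A) := by rw [hA]; nlinarith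
  have h₄ := nonneg_of_mul_nonneg_right h₃ ht0
  nlinarith

/-- A strongly convex lower semicontinuous function has a minimizer, and grows quadratically away
from it. -/
theorem StronglyGeodesicConvex.exists_quadratic_growth {X : Type*} [MetricSpace X] [Nonempty X]
    (hX : IsHadamardSpace X) {h : X → ℝ} (hh : StronglyGeodesicConvex h)
    (hl : LowerSemicontinuous h) : ∃ a, ∀ x, h a + 1 / 2 * dist x a ^ 2 ≤ h x := by
  have := hX.complete
  set m := sInf (Set.range h)
  have hbdd := hh.bddBelow hX.catZero hl
  have hm : ∀ x, m ≤ h x := fun x => csInf_le hbdd ⟨x, rfl⟩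
  have hex : ∀ n : ℕ, ∃ x, h x < m + 1 / ((n : ℝ) + 1) := fun n => by
    obtain ⟨_, ⟨x, rfl⟩, hx⟩ := exists_lt_of_csInf_lt (Set.range_nonempty h)
      (show m < m + 1 / ((n : ℝ) + 1) from lt_add_of_pos_right _ Nat.one_div_pos_of_nat)
    exact ⟨x, hx⟩
  choose x hx using hex
  have hlim : Tendsto (fun n => h (x n)) atTop (𝓝 m) := by
    refine tendsto_of_tendsto_of_tendsto_of_le_of_le tendsto_const_nhds ?_
      (fun n => hm (x n)) (fun n => (hx n).le)
    simpa using tendsto_one_div_add_atTop_nhds_zero_nat.const_add m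
  have hd : ∀ y z, dist y z ^ 2 ≤ 4 * (h y + h z - 2 * m) := fun y z => by
    obtain ⟨γ, hγ⟩ := hX.catZero.geodesic y z
    have h₁ := hh y z γ hγ ⟨1 / 2, by norm_num, by norm_num⟩
    have h₂ := hm (γ ⟨1 / 2, by norm_num, by norm_num⟩)
    norm_num at h₁ h₂
    linarith
  have hcau : CauchySeq x := by
    refine cauchySeq_of_le_tendsto_0 (fun n : ℕ => √(8 * (1 / ((n : ℝ) + 1)))) ?_ ?_
    · intro i j n hi hj
      refine Real.le_sqrt_of_sq_le ((hd _ _).trans ?_)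
      have h₁ := Nat.one_div_le_one_div (α := ℝ) hi
      have h₂ := Nat.one_div_le_one_div (α := ℝ) hj
      linarith [hx i, hx j]
    · simpa using (tendsto_one_div_add_atTop_nhds_zero_nat.const_mul (8 : ℝ)).sqrt
  obtain ⟨a, ha⟩ := cauchySeq_tendsto_of_complete hcau
  have ham : h a ≤ m := le_of_forall_lt fun c hc => by
    obtain ⟨c', hc, hc'⟩ := exists_between hc
    exact hc.trans_le (ge_of_tendsto hlim ((ha.eventually (hl a c' hc')).mono fun _ => le_of_lt))
  exact ⟨a, hh.quadratic_growth hX.catZero fun y => ham.trans (hm y)⟩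

/-! ### Saddle points of strongly concave-convex functions -/

theorem exists_saddle_point {X Y : Type*} [MetricSpace X] [MetricSpace Y] [Nonempty X] [Nonempty Y]
    (hX : IsHadamardSpace X) (hY : IsHadamardSpace Y) {g : X → Y → ℝ}
    (hconc : ∀ y, StronglyGeodesicConvex fun x => -g x y)
    (husc : ∀ y, LowerSemicontinuous fun x => -g x y)
    (hconv : ∀ x, StronglyGeodesicConvex (g x)) (hlsc : ∀ x, LowerSemicontinuous (g x)) :
    ∃ a b, ∀ x y, g x b ≤ g a b ∧ g a b ≤ g a y := by
  choose T hT using fun y => (hconc y).exists_quadratic_growth hX (husc y)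
  have hTmax : ∀ x y, g x y ≤ g (T y) y := fun x y => by
    nlinarith [hT y x, sq_nonneg (dist x (T y))]
  have hφ : StronglyGeodesicConvex fun y => g (T y) y := fun y z γ hγ t => by
    have h₁ := mul_le_mul_of_nonneg_left (hTmax (T (γ t)) y) (sub_nonneg.2 t.2.2)
    have h₂ := mul_le_mul_of_nonneg_left (hTmax (T (γ t)) z) t.2.1
    have h₃ := hconv (T (γ t)) y z γ hγ t
    dsimp only
    linarith
  have hφl : LowerSemicontinuous fun y => g (T y) y := fun y c hc =>
    (hlsc (T y) y c hc).mono fun z hz => hz.trans_le (hTmax (T y) z)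
  obtain ⟨b, hb⟩ := hφ.exists_quadratic_growth hY hφl
  refine ⟨T b, b, fun x y => ⟨hTmax x b, ?_⟩⟩
  obtain ⟨γ, hγ⟩ := hY.catZero.geodesic b y
  let τ : ℕ → unitInterval := fun n => ⟨1 / ((n : ℝ) + 2), by positivity, by
    rw [div_le_one (by positivity)]; linarith [(n.cast_nonneg : (0 : ℝ) ≤ n)]⟩
  have hτ : ∀ n, 0 < (τ n : ℝ) ∧ (τ n : ℝ) ≤ 1 / 2 := fun n =>
    ⟨by simp only [τ]; positivity, one_div_le_one_div_of_le (by norm_num) (by simp)⟩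
  have hτlim : Tendsto (fun n => (τ n : ℝ)) atTop (𝓝 0) :=
    squeeze_zero (fun n => (hτ n).1.le)
      (fun n => one_div_le_one_div_of_le (by positivity) (by linarith))
      tendsto_one_div_add_atTop_nhds_zero_nat
  have key : ∀ n, g (T b) b + (1 - τ n) * dist (T (γ (τ n))) (T b) ^ 2 / (2 * τ n)
      ≤ g (T (γ (τ n))) y := fun n => by
    obtain ⟨ht0, ht1⟩ := hτ n
    set t := τ n
    have h₁ := hconv (T (γ t)) b y γ hγ t
    have h₂ := hb (γ t)
    have h₃ := hT b (T (γ t))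
    have h₄ := mul_le_mul_of_nonneg_left h₃ (by linarith : 0 ≤ 1 - (t : ℝ))
    have h₅ : 0 ≤ (t : ℝ) * (1 - t) * dist b y ^ 2 :=
      mul_nonneg (mul_nonneg ht0.le (by linarith)) (sq_nonneg _)
    refine le_of_mul_le_mul_left ?_ ht0
    have : (t : ℝ) * ((1 - t) * dist (T (γ t)) (T b) ^ 2 / (2 * t))
        = (1 - t) * (1 / 2 * dist (T (γ t)) (T b) ^ 2) := by field_simp
    rw [mul_add, this]
    nlinarith [sq_nonneg (dist (γ t) b)]
  have hge : ∀ n, g (T b) b ≤ g (T (γ (τ n))) y := fun n => by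
    refine le_trans (le_add_of_nonneg_right ?_) (key n)
    obtain ⟨ht0, ht1⟩ := hτ n
    exact div_nonneg (mul_nonneg (by linarith) (sq_nonneg _)) (by linarith)
  have hlim : Tendsto (fun n => T (γ (τ n))) atTop (𝓝 (T b)) := by
    rw [tendsto_iff_dist_tendsto_zero]
    have hsq : ∀ n, dist (T (γ (τ n))) (T b) ≤ √(τ n * (4 * (g (T y) y - g (T b) b))) := fun n => by
      obtain ⟨ht0, ht1⟩ := hτ n
      refine Real.le_sqrt_of_sq_le ?_
      have h₁ := (key n).trans (hTmax _ y)
      have h₂ := (div_le_iff₀ (by linarith)).1 (le_sub_iff_add_le'.2 h₁)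
      nlinarith [sq_nonneg (dist (T (γ (τ n))) (T b))]
    refine squeeze_zero (fun _ => dist_nonneg) hsq ?_
    simpa using (hτlim.mul_const (4 * (g (T y) y - g (T b) b))).sqrt
  by_contra! hlt
  obtain ⟨n, hn⟩ := (hlim.eventually (husc y (T b) (-g (T b) b) (neg_lt_neg hlt))).exists
  linarith [hge n]

/-! ### The `ℓ²`-product -/

theorem dist_sq_eq {X Y : Type*} [MetricSpace X] [MetricSpace Y] (u v : WithLp 2 (X × Y)) :
    dist u v ^ 2 = dist u.fst v.fst ^ 2 + dist u.snd v.snd ^ 2 := by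
  rw [WithLp.prod_dist_eq_add (by norm_num)]
  simp only [ENNReal.toReal_ofNat, Real.rpow_two]
  rw [← Real.sqrt_eq_rpow, Real.sq_sqrt (by positivity)]

/-- The quadrilateral inequality for the `ℓ²`-product of two `CAT(0)` spaces. -/
theorem prod_quadrilateral {X Y : Type*} [MetricSpace X] [MetricSpace Y]
    (hX : IsCATZero X) (hY : IsCATZero Y) (a b c d : WithLp 2 (X × Y)) :
    dist a c ^ 2 + dist b d ^ 2 ≤ dist a d ^ 2 + dist b c ^ 2 + 2 * (dist a b * dist c d) := by
  have h₁ := hX.quadrilateral a.fst b.fst c.fst d.fst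
  have h₂ := hY.quadrilateral a.snd b.snd c.snd d.snd
  have hcs : dist a.fst b.fst * dist c.fst d.fst + dist a.snd b.snd * dist c.snd d.snd
      ≤ dist a b * dist c d := by
    refine (sq_le_sq₀ (by positivity) (by positivity)).1 ?_
    rw [mul_pow, dist_sq_eq a b, dist_sq_eq c d]
    nlinarith [sq_nonneg (dist a.fst b.fst * dist c.snd d.snd
      - dist a.snd b.snd * dist c.fst d.fst)]
  simp only [dist_sq_eq a c, dist_sq_eq b d, dist_sq_eq a d, dist_sq_eq b c]
  linarith

/-! ### The regularized saddle function -/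

/-- A convex function plus half the squared distance to a point is strongly convex. -/
theorem GeodesicConvex.add_half_dist_sq {X : Type*} [MetricSpace X] (hX : IsCATZero X)
    {h : X → ℝ} (hh : GeodesicConvex h) {l : ℝ} (hl : 0 ≤ l) (a : X) (c : ℝ) :
    StronglyGeodesicConvex fun x => l * h x + 1 / 2 * dist x a ^ 2 + c := fun x y γ hγ t => by
  have h₁ := mul_le_mul_of_nonneg_left (hh x y γ hγ t) hl
  have h₂ := hX.dist_sq_le hγ a t
  dsimp only
  linarith

theorem LowerSemicontinuous.add_half_dist_sq {X : Type*} [MetricSpace X]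
    {h : X → ℝ} (hh : LowerSemicontinuous h) {l : ℝ} (hl : 0 ≤ l) (a : X) (c : ℝ) :
    LowerSemicontinuous fun x => l * h x + 1 / 2 * dist x a ^ 2 + c :=
  (((continuous_const_mul l).comp_lowerSemicontinuous hh
    (monotone_mul_left_of_nonneg hl)).add (Continuous.lowerSemicontinuous (by fun_prop))).add
    lowerSemicontinuous_const

section Prox

variable {X Y : Type*} [MetricSpace X] [MetricSpace Y] {f : X → Y → ℝ}

theorem neg_proxFunction_eq (f : X → Y → ℝ) (l : ℝ) (u : WithLp 2 (X × Y)) (y : Y) :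
    (fun x => -proxFunction (fun x y => l * f x y) u x y)
      = fun x => l * -f x y + 1 / 2 * dist x u.fst ^ 2 + -(1 / 2 * dist y u.snd ^ 2) := by
  ext x; simp only [proxFunction]; ring

theorem proxFunction_eq (f : X → Y → ℝ) (l : ℝ) (u : WithLp 2 (X × Y)) (x : X) :
    proxFunction (fun x y => l * f x y) u x
      = fun y => l * f x y + 1 / 2 * dist y u.snd ^ 2 + -(1 / 2 * dist x u.fst ^ 2) := by
  ext y; simp only [proxFunction]; ring

theorem IsSaddleFunction.neg_lsc (hf : IsSaddleFunction f) (y : Y) :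
    LowerSemicontinuous fun x => -f x y := fun x c hc =>
  (hf.usc y x (-c) (lt_neg_of_lt_neg hc)).mono fun _ hz => lt_neg_of_lt_neg hz

theorem saddleSet_proxFunction_nonempty (hX : IsHadamardSpace X) (hY : IsHadamardSpace Y)
    (hf : IsSaddleFunction f) {l : ℝ} (hl : 0 < l) (u : WithLp 2 (X × Y)) :
    (saddleSet (proxFunction (fun x y => l * f x y) u)).Nonempty := by
  have : Nonempty X := ⟨u.fst⟩
  have : Nonempty Y := ⟨u.snd⟩
  obtain ⟨a, b, hab⟩ := exists_saddle_point hX hY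
    (g := proxFunction (fun x y => l * f x y) u)
    (fun y => by
      rw [neg_proxFunction_eq]; exact (hf.concave y).add_half_dist_sq hX.catZero hl.le _ _)
    (fun y => by rw [neg_proxFunction_eq]; exact (hf.neg_lsc y).add_half_dist_sq hl.le _ _)
    (fun x => by
      rw [proxFunction_eq]; exact (hf.convex x).add_half_dist_sq hY.catZero hl.le _ _)
    (fun x => by rw [proxFunction_eq]; exact (hf.lsc x).add_half_dist_sq hl.le _ _)
  exact ⟨WithLp.toLp 2 (a, b), hab⟩

/-- The resolvent inequality: quadratic growth in both variables at the saddle point `p`. -/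
theorem saddle_prox_inequality (hX : IsHadamardSpace X) (hY : IsHadamardSpace Y)
    (hf : IsSaddleFunction f) {l : ℝ} (hl : 0 < l) {u p : WithLp 2 (X × Y)}
    (hp : p ∈ saddleSet (proxFunction (fun x y => l * f x y) u)) (u' : WithLp 2 (X × Y)) :
    dist p u' ^ 2 + dist p u ^ 2 + 2 * l * (f u'.fst p.snd - f p.fst u'.snd) ≤ dist u u' ^ 2 := by
  have h₁ := StronglyGeodesicConvex.quadratic_growth hX.catZero
    (h := fun x => -proxFunction (fun x y => l * f x y) u x p.snd)
    (by rw [neg_proxFunction_eq]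
        exact (hf.concave p.snd).add_half_dist_sq hX.catZero hl.le _ _)
    (fun x => neg_le_neg (hp x p.snd).1) u'.fst
  have h₂ := StronglyGeodesicConvex.quadratic_growth hY.catZero
    (h := proxFunction (fun x y => l * f x y) u p.fst)
    (by rw [proxFunction_eq]; exact (hf.convex p.fst).add_half_dist_sq hY.catZero hl.le _ _)
    (fun y => (hp p.fst y).2) u'.snd
  simp only [proxFunction] at h₁ h₂
  rw [dist_sq_eq p u', dist_sq_eq p u, dist_sq_eq u u', dist_comm u.fst, dist_comm u.snd,
    dist_comm p.fst u'.fst, dist_comm p.snd u'.snd]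
  linarith

/-- Adding the resolvent inequalities for `(l, u)` and `(m, u')` with weights `m` and `l` cancels
the values of `f`. -/
theorem two_saddle_prox_inequality (hX : IsHadamardSpace X) (hY : IsHadamardSpace Y)
    (hf : IsSaddleFunction f) {l m : ℝ} (hl : 0 < l) (hm : 0 < m) {u u' p q : WithLp 2 (X × Y)}
    (hp : p ∈ saddleSet (proxFunction (fun x y => l * f x y) u))
    (hq : q ∈ saddleSet (proxFunction (fun x y => m * f x y) u')) :
    (l + m) * dist p q ^ 2 + m * dist p u ^ 2 + l * dist q u' ^ 2
      ≤ l * dist p u' ^ 2 + m * dist q u ^ 2 := by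
  have h₁ := mul_le_mul_of_nonneg_left (saddle_prox_inequality hX hY hf hl hp q) hm.le
  have h₂ := mul_le_mul_of_nonneg_left (saddle_prox_inequality hX hY hf hm hq p) hl.le
  rw [dist_comm q p, dist_comm u' p] at h₂
  rw [dist_comm u q] at h₁
  linarith

theorem saddleSet_proxFunction_eq_singleton (hX : IsHadamardSpace X) (hY : IsHadamardSpace Y)
    (hf : IsSaddleFunction f) {l : ℝ} (hl : 0 < l) (u : WithLp 2 (X × Y)) :
    saddleSet (proxFunction (fun x y => l * f x y) u) = {scaledResolvent f l u} := by
  have hne := saddleSet_proxFunction_nonempty hX hY hf hl u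
  have hmem : scaledResolvent f l u ∈ saddleSet (proxFunction (fun x y => l * f x y) u) := by
    rw [scaledResolvent, saddleResolvent, dif_pos hne]
    exact hne.some_mem
  refine Set.Subset.antisymm (fun q hq => ?_) (Set.singleton_subset_iff.2 hmem)
  have h := two_saddle_prox_inequality hX hY hf hl hl hq hmem
  have h₁ : l * dist q (scaledResolvent f l u) ^ 2 ≤ 0 := by linarith
  have h₂ : dist q (scaledResolvent f l u) ^ 2 ≤ 0 := nonpos_of_mul_nonpos_right h₁ hl
  exact dist_eq_zero.1 (pow_eq_zero_iff two_ne_zero |>.1 (h₂.antisymm (sq_nonneg _)))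

theorem fixedPoints_scaledResolvent (hX : IsHadamardSpace X) (hY : IsHadamardSpace Y)
    (hf : IsSaddleFunction f) {l : ℝ} (hl : 0 < l) :
    Function.fixedPoints (scaledResolvent f l) = saddleSet f := by
  ext p
  have hs := saddleSet_proxFunction_eq_singleton hX hY hf hl p
  constructor
  · intro hp
    have hmem : p ∈ saddleSet (proxFunction (fun x y => l * f x y) p) := by
      rw [hs]; exact (Function.mem_fixedPoints_iff.1 hp).symm
    have key : ∀ x y, f x p.snd ≤ f p.fst y := fun x y => by
      have h := saddle_prox_inequality hX hY hf hl hmem (WithLp.toLp 2 (x, y))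
      rw [dist_self] at h
      have h' : l * (f x p.snd - f p.fst y) ≤ 0 := by
        have : 2 * l * (f x p.snd - f p.fst y) ≤ 0 := by simpa using h
        linarith
      linarith [nonpos_of_mul_nonpos_right h' hl]
    exact fun x y => ⟨key x p.snd, key p.fst y⟩
  · intro hp
    have hmem : p ∈ saddleSet (proxFunction (fun x y => l * f x y) p) := fun x y => by
      have h₁ := mul_le_mul_of_nonneg_left (hp x y).1 hl.le
      have h₂ := mul_le_mul_of_nonneg_left (hp x y).2 hl.le
      simp only [proxFunction, dist_self]
      constructor <;> nlinarith [sq_nonneg (dist x p.fst), sq_nonneg (dist y p.snd)]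
    rw [hs] at hmem
    exact Function.mem_fixedPoints_iff.2 (Set.mem_singleton_iff.1 hmem).symm

end Prox

theorem mainTheorem5 {X Y : Type*} [MetricSpace X] [MetricSpace Y]
    (hX : IsHadamardSpace X) (hY : IsHadamardSpace Y)
    (f : X → Y → ℝ) (hf : IsSaddleFunction f) :
    -- (i) each `scaledResolvent f l u` is the unique saddle point, and `Fix = Saddle`
    (∀ l : ℝ, 0 < l →
      (∀ u, saddleSet (proxFunction (fun x y => l * f x y) u) = {scaledResolvent f l u}) ∧
      Function.fixedPoints (scaledResolvent f l) = saddleSet f) ∧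
    -- (ii)
    (∀ l : ℝ, 0 < l → ∀ u u' : WithLp 2 (X × Y),
      dist (scaledResolvent f l u) u' ^ 2 + dist (scaledResolvent f l u) u ^ 2
        + 2 * l * (f u'.fst (scaledResolvent f l u).snd - f (scaledResolvent f l u).fst u'.snd)
        ≤ dist u u' ^ 2) ∧
    -- (iii)
    (∀ l m : ℝ, 0 < l → 0 < m → ∀ u u' : WithLp 2 (X × Y),
      (l + m) * dist (scaledResolvent f l u) (scaledResolvent f m u') ^ 2
        + m * dist (scaledResolvent f l u) u ^ 2
        + l * dist (scaledResolvent f m u') u' ^ 2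
        ≤ l * dist (scaledResolvent f l u) u' ^ 2
          + m * dist (scaledResolvent f m u') u ^ 2) ∧
    -- (iv)
    (∀ l : ℝ, 0 < l →
      FirmlyMetricallyNonspreading (scaledResolvent f l) ∧ Nonexpansive (scaledResolvent f l)) ∧
    -- (v)
    (∀ l m : ℝ, 0 < l → 0 < m → ∀ u : WithLp 2 (X × Y),
      1 / m * dist (scaledResolvent f m (scaledResolvent f l u)) (scaledResolvent f l u)
        ≤ 1 / l * dist (scaledResolvent f l u) u) := by
  have hs : ∀ {l : ℝ}, 0 < l → ∀ u,
      scaledResolvent f l u ∈ saddleSet (proxFunction (fun x y => l * f x y) u) := fun hl u => by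
    rw [saddleSet_proxFunction_eq_singleton hX hY hf hl u]; rfl
  have hfirm : ∀ l : ℝ, 0 < l → FirmlyMetricallyNonspreading (scaledResolvent f l) :=
    fun l hl u v => by
      have h := two_saddle_prox_inequality hX hY hf hl hl (hs hl u) (hs hl v)
      refine le_of_mul_le_mul_left ?_ hl
      linarith
  refine ⟨fun l hl => ⟨saddleSet_proxFunction_eq_singleton hX hY hf hl,
      fixedPoints_scaledResolvent hX hY hf hl⟩,
    fun l hl u u' => saddle_prox_inequality hX hY hf hl (hs hl u) u',
    fun l m hl hm u u' => two_saddle_prox_inequality hX hY hf hl hm (hs hl u) (hs hm u'),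
    fun l hl => ⟨hfirm l hl, fun u v => ?_⟩, fun l m hl hm u => ?_⟩
  · have h₁ := hfirm l hl u v
    have h₂ := prod_quadrilateral hX.catZero hY.catZero
      (scaledResolvent f l u) (scaledResolvent f l v) v u
    rw [dist_comm v u] at h₂
    rcases (dist_nonneg : 0 ≤ dist (scaledResolvent f l u) (scaledResolvent f l v)).eq_or_lt
      with h | h
    · rw [← h]; exact dist_nonneg
    · refine le_of_mul_le_mul_left ?_ h
      linarith
  · have h := two_saddle_prox_inequality hX hY hf hl hm (hs hl u) (hs hm (scaledResolvent f l u))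
    set p := scaledResolvent f l u
    set q := scaledResolvent f m p
    rw [dist_self, dist_comm p q] at h
    have htri : dist q u ^ 2 ≤ (dist q p + dist p u) ^ 2 :=
      pow_le_pow_left₀ dist_nonneg (dist_triangle q p u) 2
    have h' := mul_le_mul_of_nonneg_left htri hm.le
    rw [one_div_mul_eq_div, one_div_mul_eq_div, div_le_div_iff₀ hm hl]
    rcases (dist_nonneg : 0 ≤ dist q p).eq_or_lt with h0 | h0
    · rw [← h0, zero_mul]; positivity
    · refine le_of_mul_le_mul_left ?_ h0
      linarith
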